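/- **Setting.** Let $d\in\{2,3\}$ and let $\Omega\subset\mathbb R^d$ be a bounded Lipschitz polygonal/polyhedral domain of diameter at most $1$. Let $A$ (symmetric-matrix-valued) and $n$ (real-valued) be measurable with $|\xi|^2\le A(x)\xi\cdot\xi\le a_{\max}|\xi|^2$ and $n_{\min}\le n(x)\le 1$ for a.e. $x\in\Omega$ and all $\xi\in\mathbb R^d$, where $a_{\max}\ge 1$, $0<n_{\min}\le 1$, and let $k\ge k_0>0$. For open $U\subseteq\Omega$ put $$b_U(u,v)=\int_U (A\nabla u\cdot\nabla v-k^2 n uv)\,dx,\qquad (u,v)_{1,k,U}=\int_U (A\nabla u\cdot\nabla v+k^2 n uv)\,dx,$$ and $\|u\|_{1,k}=(u,u)_{1,k,\Omega}^{1/2}$. Assume that for every $f\in L^2(\Omega)$ there is a unique $u\in H^1_0(\Omega)$ with $b_\Omega(u,v)=\int_\Omega fv\,dx$ for all $v\in H_0^1(\Omega)$, and that $\|u\|_{1,k}\le C_{\rm stab}\|f\|_{L^2(\Omega)}$, where $C_{\rm stab}>0$. Let $\mathcal T_h$ be a conforming simplicial mesh on $\Omega$, shape regular with constant $C_{\rm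 SR}>0$, and let $V^h\subset H^1_0(\Omega)$ be the Lagrange finite element space of degree $r\ge1$ on it, with nodal basis functions $\phi_l$. Assume the inverse estimate $\|\nabla v\|_{L^2(T)}\le C_{\rm inv}k\|v\|_{L^2(T)}$ for all $T\in\mathcal T_h$ and $v\in V^h$, with $C_{\rm inv}\ge1$. Let $\Omega=\bigcup_{i=1}^N\Omega_i^c=\bigcup_{j=1}^Q\Omega_j^\ell$ be two covers by open subdomains, each of which is composed of a union of mesh elements. Let $H_\ell=\max_j\operatorname{diam}\Omega_j^\ell$, and let $\Lambda_c$, respectively $\Lambda_\ell$, be the maximal number of subdomains of the first, respectively second, cover whose closures contain a common mesh element. For each $i$ let $\operatorname{dof}(\Omega_i^c)=\{l:\operatorname{supp}\phi_l\subseteq\overline{\Omega_i^c}\}$, let $\mu_l=\#\{i: l\in\operatorname{dof}(\Omega_i^c)\}$, and for $v\in\widetilde V_i=\{w|_{\Omega_i^c}:w\in V^h\}$ with nodal values $v_l$ let $\Xi_i v=\sum_{l\in\operatorname{dof}(\Omega_i^c)}\mu_l^{-1}v_l\phi_l$. Let $\lambda_1^i\le\lambda_2^i\le\cdots$ be the finite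 eigenvalues (with multiplicity) of the problem: find $0\ne p\in\widetilde V_i$ and $\lambda\in\mathbb R$ with $$b_{\Omega_i^c}(p,v)=\lambda\,(\Xi_i p,\Xi_i v)_{1,k,\Omega_i^c}\qquad\text{for all } v\in\widetilde V_i,$$ the corresponding eigenfunctions being chosen orthonormal with respect to the form on the right-hand side and spanning $\widetilde V_i$ together with the kernel of that form. Let $m_i\ge1$ be such that $\lambda^i_{m_i+1}$ exists and is positive, for each $i$, and put $$\tau=\min_{1\le i\le N}\lambda^i_{m_i+1},\qquad \Theta=\frac1\tau,\qquad C_*=\Lambda_c^2n_{\min}^{-1}(a_{\max}C_{\rm inv}^2+2)^2\,C_{\rm inv}^2 .$$ For constants $C_2>0$ and $C_3\ge1$ define $$s=2C_3\bigl(1+\Lambda_\ell\Lambda_c^2a_{\max}n_{\min}^{-1}C_*\Theta\bigr)\Bigl(2C_2\Lambda_c(a_{\max}n_{\min}^{-1}C_*)^{1/2}k\,\Theta^{1/2}(1+C_{\rm stab})+3k\Lambda_\ell H_\ell\Bigr),$$ $$\gamma=\frac{1-s}{C_3\bigl(1+\Lambda_\ell\Lambda_c^2a_{\max}n_{\min}^{-1}C_*\Theta\bigr)(18+8\Lambda_\ell^2)}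 .$$ **Corollary.** Let $C_2>0$ and $C_3\ge1$ be arbitrary constants (in particular, they may be the ones of the GMRES convergence theorem, in which $s<1$ is the condition and $\gamma$ governs the rate). (a) There is a constant $C>0$, depending only on $C_2$ and $C_3$, such that in every setting as above, $s<1$ implies $$kH_\ell\le C\qquad\text{and}\qquad(1+C_{\rm stab})^2k^2\,\Theta\le C.\tag{1}$$ (b) Conversely, fix $\Lambda_\ell,\Lambda_c,a_{\max},n_{\min},C_{\rm inv},k_0$ (and hence $C_*$), and let $C>0$ be so small that $$2C_3\bigl(1+\Lambda_\ell\Lambda_c^2a_{\max}n_{\min}^{-1}C_*\,C\,k_0^{-2}\bigr)\Bigl(2C_2\Lambda_c(a_{\max}n_{\min}^{-1}C_*C)^{1/2}+3\Lambda_\ell C\Bigr)<1 .$$ Then there is $\gamma_0>0$, depending only on the quantities just listed and on $C_2$, $C_3$ and $C$ (in particular not on $k$), such that in every setting as above with these values of $\Lambda_\ell,\Lambda_c,a_{\max},n_{\min},C_{\rm inv},k_0$, the bounds (1) imply $s<1$ and $\gamma\ge\gamma_0$. -/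

import Mathlib

open Set Filter Topology MeasureTheory
open scoped ContDiff Gradient

namespace HkGenEO

/-- Euclidean space `ℝᵈ`. -/
abbrev E (d : ℕ) := EuclideanSpace ℝ (Fin d)

section Sobolev

variable {d : ℕ}

/-- Test functions: smooth functions with compact support contained in `U`. -/
def IsTest (U : Set (E d)) (φ : E d → ℝ) : Prop :=
  ContDiff ℝ ∞ φ ∧ HasCompactSupport φ ∧ tsupport φ ⊆ U

/-- `u ∈ H¹(U)` with weak gradient `G`: both are square integrable on `U` and
`∫_U u ∇φ = - ∫_U φ G` for all test functions `φ`. -/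
def HasWeakGrad (U : Set (E d)) (u : E d → ℝ) (G : E d → E d) : Prop :=
  MemLp u 2 (volume.restrict U) ∧ MemLp G 2 (volume.restrict U) ∧
    ∀ φ : E d → ℝ, IsTest U φ →
      ∫ x in U, u x • gradient φ x = - ∫ x in U, φ x • G x

open Classical in
/-- The weak gradient on the open set `U` of a function of `H¹(U)` (unique almost everywhere). -/
noncomputable def weakGrad (U : Set (E d)) (u : E d → ℝ) : E d → E d :=
  if h : ∃ G, HasWeakGrad U u G then h.choose else 0

/-- `H¹₀(U)`: the closure of the test functions in `H¹(U)`. -/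
def IsH10 (U : Set (E d)) (u : E d → ℝ) : Prop :=
  (∃ G, HasWeakGrad U u G) ∧ ∃ φ : ℕ → E d → ℝ, (∀ m, IsTest U (φ m)) ∧
    Tendsto (fun m => eLpNorm (fun x => u x - φ m x) 2 (volume.restrict U)) atTop (𝓝 0) ∧
    Tendsto (fun m => eLpNorm (fun x => weakGrad U u x - gradient (φ m) x) 2
      (volume.restrict U)) atTop (𝓝 0)

/-- The `L²(U)` norm. -/
noncomputable def l2norm (U : Set (E d)) (u : E d → ℝ) : ℝ :=
  √(∫ x in U, u x ^ 2)

/-- `a_U(u,v) = ∫_U A ∇u · ∇v`. -/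
noncomputable def aForm (A : E d → Matrix (Fin d) (Fin d) ℝ) (U : Set (E d))
    (u v : E d → ℝ) : ℝ :=
  ∫ x in U, ∑ i, ∑ j, A x i j * weakGrad U u x j * weakGrad U v x i

/-- The weighted inner product `(u,v)_{n,U} = ∫_U n u v`. -/
noncomputable def nForm (n : E d → ℝ) (U : Set (E d)) (u v : E d → ℝ) : ℝ :=
  ∫ x in U, n x * u x * v x

/-- `b_U(u,v) = a_U(u,v) - k² (u,v)_{n,U}`. -/
noncomputable def bForm (A : E d → Matrix (Fin d) (Fin d) ℝ) (n : E d → ℝ) (k : ℝ)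
    (U : Set (E d)) (u v : E d → ℝ) : ℝ :=
  aForm A U u v - k ^ 2 * nForm n U u v

/-- `(u,v)_{1,k,U} = a_U(u,v) + k² (u,v)_{n,U}`. -/
noncomputable def kForm (A : E d → Matrix (Fin d) (Fin d) ℝ) (n : E d → ℝ) (k : ℝ)
    (U : Set (E d)) (u v : E d → ℝ) : ℝ :=
  aForm A U u v + k ^ 2 * nForm n U u v

/-- `u ∈ H¹₀(U)` is a weak solution of `-∇·(A∇u) - k² n u = f` in `U`, `u = 0` on `∂U`. -/
def IsWeakSolution (A : E d → Matrix (Fin d) (Fin d) ℝ) (n : E d → ℝ) (k : ℝ)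
    (U : Set (E d)) (f u : E d → ℝ) : Prop :=
  IsH10 U u ∧ ∀ v, IsH10 U v → bForm A n k U u v = ∫ x in U, f x * v x

/-- For every `f ∈ L²(U)` the boundary value problem has a unique weak solution `u`, and
`‖u‖_{1,k} ≤ Cstab ‖f‖`. -/
def StablySolvable (A : E d → Matrix (Fin d) (Fin d) ℝ) (n : E d → ℝ) (k : ℝ)
    (U : Set (E d)) (Cstab : ℝ) : Prop :=
  ∀ f : E d → ℝ, MemLp f 2 (volume.restrict U) →
    ∃ u, IsWeakSolution A n k U f u ∧
      (∀ w, IsWeakSolution A n k U f w → w =ᵐ[volume.restrict U] u) ∧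
      √(kForm A n k U u u) ≤ Cstab * l2norm U f

/-- Lipschitz boundary: near each of its boundary points, `U` is the strict epigraph of a Lipschitz
function, in the direction of some unit vector `ν`. -/
def HasLipschitzBoundary (U : Set (E d)) : Prop :=
  ∀ x ∈ frontier U, ∃ (ν : E d) (g : E d → ℝ) (L : NNReal), ‖ν‖ = 1 ∧ LipschitzWith L g ∧
    ∀ᶠ y in 𝓝 x, (y ∈ U ↔ g (y - (inner ℝ ν y) • ν) < inner ℝ ν y)

end Sobolev

section Mesh

variable {d : ℕ}

/-- The mesh elements: the `d`-simplices of the complex, given by their sets of vertices. The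
(closed) element itself is the convex hull. -/
def elements (K : Geometry.SimplicialComplex ℝ (E d)) : Set (Finset (E d)) :=
  {T | T ∈ K.faces ∧ T.card = d + 1}

/-- `K` is a (conforming, finite) simplicial mesh on `Ω`. -/
structure IsMeshOf (K : Geometry.SimplicialComplex ℝ (E d)) (Ω : Set (E d)) : Prop where
  finite : K.faces.Finite
  pure : ∀ s ∈ K.faces, ∃ T ∈ elements K, s ⊆ T
  space_eq : K.space = closure Ω

/-- Shape regularity: every element `T` contains a ball of diameter at least `CSR * diam T`. -/
def ShapeRegular (K : Geometry.SimplicialComplex ℝ (E d)) (CSR : ℝ) : Prop :=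
  ∀ T ∈ elements K, ∃ (x : E d) (ρ : ℝ), CSR * Metric.diam (convexHull ℝ (T : Set (E d))) ≤ ρ ∧
    Metric.closedBall x (ρ / 2) ⊆ convexHull ℝ (T : Set (E d))

/-- `U` is an (open) subdomain composed of a union of mesh elements. -/
def Resolved (K : Geometry.SimplicialComplex ℝ (E d)) (U : Set (E d)) : Prop :=
  ∃ S ⊆ elements K, U = interior (⋃ T ∈ S, convexHull ℝ (T : Set (E d)))

/-- The maximal number of members of the family `U` that contain a common mesh element
(up to boundary). -/
noncomputable def overlapNumber (K : Geometry.SimplicialComplex ℝ (E d)) {N : ℕ}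
    (U : Fin N → Set (E d)) : ℕ :=
  sSup {c | ∃ T ∈ elements K, c = {i | convexHull ℝ (T : Set (E d)) ⊆ closure (U i)}.ncard}

/-- The space `V^h`: continuous functions that vanish outside `Ω` and are polynomials of degree at
most `r` on each element. -/
noncomputable def feSpace (K : Geometry.SimplicialComplex ℝ (E d)) (Ω : Set (E d)) (r : ℕ) :
    Submodule ℝ (E d → ℝ) where
  carrier := {v | Continuous v ∧ (∀ x ∉ Ω, v x = 0) ∧
    ∀ T ∈ elements K, ∃ p : MvPolynomial (Fin d) ℝ, p.totalDegree ≤ r ∧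
      ∀ x ∈ convexHull ℝ (T : Set (E d)), v x = MvPolynomial.eval (fun i => x i) p}
  add_mem' := by
    rintro v w ⟨hv, hv0, hvp⟩ ⟨hw, hw0, hwp⟩
    refine ⟨hv.add hw, fun x hx => by simp [hv0 x hx, hw0 x hx], fun T hT => ?_⟩
    obtain ⟨p, hp, hpe⟩ := hvp T hT
    obtain ⟨q, hq, hqe⟩ := hwp T hT
    exact ⟨p + q, (MvPolynomial.totalDegree_add p q).trans (max_le hp hq),
      fun x hx => by simp [hpe x hx, hqe x hx]⟩
  zero_mem' := ⟨continuous_const, fun _ _ => rfl, fun _ _ => ⟨0, by simp, fun _ _ => by simp⟩⟩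
  smul_mem' := by
    rintro c v ⟨hv, hv0, hvp⟩
    refine ⟨hv.const_smul c, fun x hx => by simp [hv0 x hx], fun T hT => ?_⟩
    obtain ⟨p, hp, hpe⟩ := hvp T hT
    exact ⟨c • p, (MvPolynomial.totalDegree_smul_le c p).trans hp,
      fun x hx => by simp [hpe x hx, MvPolynomial.smul_eval]⟩

/-- Restriction of functions to `U` (restricted functions are represented by their extension by zero
outside `U`), as a linear map. -/
noncomputable def restrictTo (U : Set (E d)) : (E d → ℝ) →ₗ[ℝ] (E d → ℝ) where
  toFun v := U.indicator v
  map_add' v w := Set.indicator_add U v w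
  map_smul' c v := Set.indicator_const_smul U c v

/-- The space `{v|_U : v ∈ V^h}`. -/
noncomputable def restrictedSpace (K : Geometry.SimplicialComplex ℝ (E d)) (Ω : Set (E d)) (r : ℕ)
    (U : Set (E d)) : Submodule ℝ (E d → ℝ) :=
  (feSpace K Ω r).map (restrictTo U)

/-- The degrees of freedom of `V^h`, represented by the Lagrange nodes of order `r` of the mesh that
do not lie on `∂Ω`: in an element with vertices `v₀, …, v_d` these are the points
`∑ (α_j / r) v_j` with `α_j ∈ ℕ`, `∑ α_j = r`. -/
def nodes (K : Geometry.SimplicialComplex ℝ (E d)) (Ω : Set (E d)) (r : ℕ) : Set (E d) :=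
  {x | x ∈ Ω ∧ ∃ T ∈ elements K, ∃ α : E d → ℕ, ∑ v ∈ T, α v = r ∧
    x = ∑ v ∈ T, ((α v : ℝ) / (r : ℝ)) • v}

open Classical in
/-- The nodal basis function of `V^h` that belongs to the node `z`. -/
noncomputable def nodalBasis (K : Geometry.SimplicialComplex ℝ (E d)) (Ω : Set (E d)) (r : ℕ)
    (z : E d) : E d → ℝ :=
  if h : ∃ φ ∈ feSpace K Ω r, ∀ y ∈ nodes K Ω r, φ y = if y = z then 1 else 0 then h.choose else 0

/-- The interior degrees of freedom of `U`: those with `supp φ_z ⊆ closure U`. -/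
def dof (K : Geometry.SimplicialComplex ℝ (E d)) (Ω : Set (E d)) (r : ℕ) (U : Set (E d)) :
    Set (E d) :=
  {z | z ∈ nodes K Ω r ∧ tsupport (nodalBasis K Ω r z) ⊆ closure U}

/-- `μ_z`: the number of subdomains for which `z` is an interior degree of freedom. -/
noncomputable def multiplicity (K : Geometry.SimplicialComplex ℝ (E d)) (Ω : Set (E d)) (r : ℕ)
    {N : ℕ} (U : Fin N → Set (E d)) (z : E d) : ℕ :=
  {i | z ∈ dof K Ω r (U i)}.ncard

/-- The partition of unity operator `Ξ_i(v) = ∑_{z ∈ dof(U_i)} μ_z⁻¹ v(z) φ_z`. -/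
noncomputable def pou (K : Geometry.SimplicialComplex ℝ (E d)) (Ω : Set (E d)) (r : ℕ)
    {N : ℕ} (U : Fin N → Set (E d)) (i : Fin N) (v : E d → ℝ) : E d → ℝ :=
  fun x => ∑ᶠ z ∈ dof K Ω r (U i), (multiplicity K Ω r U z : ℝ)⁻¹ * v z * nodalBasis K Ω r z x

end Mesh

/-- `lam 0 ≤ lam 1 ≤ ⋯ ≤ lam (q-1)` are all the finite eigenvalues (with multiplicity) of the
generalised eigenvalue problem `b(p,v) = lam c(p,v)` for all `v ∈ W`, and the `p j` are
corresponding `c`-orthonormal eigenvectors, which together with `ker c` span `W`. -/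
structure IsEigensystem {X : Type*} [AddCommGroup X] [Module ℝ X] (W : Submodule ℝ X)
    (b c : X → X → ℝ) {q : ℕ} (lam : Fin q → ℝ) (p : Fin q → X) : Prop where
  mem : ∀ j, p j ∈ W
  eigen : ∀ j, ∀ v ∈ W, b (p j) v = lam j * c (p j) v
  mono : Monotone lam
  orthonormal : ∀ i j, c (p i) (p j) = if i = j then 1 else 0
  complete : ∀ v ∈ W, ∃ v₀ ∈ W, (∀ w ∈ W, c v₀ w = 0) ∧ v = v₀ + ∑ j, c v (p j) • p j

/-- The data: problem, discretisation, the two covers, the local eigenpairs and the chosen numbers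
of modes. -/
structure Config (d : ℕ) where
  /-- domain -/
  Ω : Set (E d)
  /-- diffusion coefficient -/
  A : E d → Matrix (Fin d) (Fin d) ℝ
  /-- zeroth order coefficient -/
  n : E d → ℝ
  /-- wavenumber -/
  k : ℝ
  /-- lower bound for the wavenumber -/
  k₀ : ℝ
  /-- upper bound for `A` -/
  amax : ℝ
  /-- lower bound for `n` -/
  nmin : ℝ
  /-- stability constant of the boundary value problem -/
  Cstab : ℝ
  /-- mesh -/
  K : Geometry.SimplicialComplex ℝ (E d)
  /-- shape regularity constant -/
  CSR : ℝ
  /-- constant in the inverse estimate -/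
  Cinv : ℝ
  /-- polynomial degree -/
  r : ℕ
  /-- number of coarse-space subdomains -/
  N : ℕ
  /-- coarse-space subdomains -/
  coarse : Fin N → Set (E d)
  /-- number of local subdomains -/
  Q : ℕ
  /-- local subdomains -/
  loc : Fin Q → Set (E d)
  /-- number of finite eigenvalues on each coarse-space subdomain -/
  q : Fin N → ℕ
  /-- eigenvalues on each coarse-space subdomain -/
  lam : ∀ i, Fin (q i) → ℝ
  /-- eigenfunctions on each coarse-space subdomain -/
  p : ∀ i, Fin (q i) → E d → ℝ
  /-- number of eigenfunctions selected on each coarse-space subdomain; since eigenvalues are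
  numbered from `0` here, `lam i (m i)` is the first one that is not selected -/
  m : ∀ i, Fin (q i)

namespace Config

variable {d : ℕ} (P : Config d)

/-- `c_i(w,v) = (Ξ_i w, Ξ_i v)_{1,k}` on the `i`-th coarse-space subdomain. -/
noncomputable def cForm (i : Fin P.N) (w v : E d → ℝ) : ℝ :=
  kForm P.A P.n P.k (P.coarse i) (pou P.K P.Ω P.r P.coarse i w) (pou P.K P.Ω P.r P.coarse i v)

/-- The standing assumptions. -/
structure Valid : Prop where
  dim : d = 2 ∨ d = 3
  -- the domain
  isOpen : IsOpen P.Ω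
  isConnected : IsConnected P.Ω
  lipschitz : HasLipschitzBoundary P.Ω
  diam_le : Metric.diam P.Ω ≤ 1
  -- the coefficients
  A_meas : ∀ i j, Measurable fun x => P.A x i j
  n_meas : Measurable P.n
  A_symm : ∀ᵐ x ∂(volume.restrict P.Ω), (P.A x).IsSymm
  one_le_amax : 1 ≤ P.amax
  A_bounds : ∀ᵐ x ∂(volume.restrict P.Ω), ∀ ξ : E d,
    ‖ξ‖ ^ 2 ≤ ∑ i, ∑ j, P.A x i j * ξ j * ξ i ∧
    ∑ i, ∑ j, P.A x i j * ξ j * ξ i ≤ P.amax * ‖ξ‖ ^ 2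
  nmin_pos : 0 < P.nmin
  nmin_le_one : P.nmin ≤ 1
  n_bounds : ∀ᵐ x ∂(volume.restrict P.Ω), P.nmin ≤ P.n x ∧ P.n x ≤ 1
  -- the wavenumber
  k₀_pos : 0 < P.k₀
  k₀_le : P.k₀ ≤ P.k
  -- well-posedness
  Cstab_pos : 0 < P.Cstab
  stable : StablySolvable P.A P.n P.k P.Ω P.Cstab
  -- the finite element space
  one_le_r : 1 ≤ P.r
  mesh : IsMeshOf P.K P.Ω
  CSR_pos : 0 < P.CSR
  shapeRegular : ShapeRegular P.K P.CSR
  one_le_Cinv : 1 ≤ P.Cinv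
  inverse : ∀ T ∈ elements P.K, ∀ v ∈ feSpace P.K P.Ω P.r,
    √(∫ x in convexHull ℝ (T : Set (E d)), ‖weakGrad P.Ω v x‖ ^ 2) ≤
      P.Cinv * P.k * l2norm (convexHull ℝ (T : Set (E d))) v
  -- the two covers
  coarse_resolved : ∀ i, Resolved P.K (P.coarse i)
  coarse_cover : P.Ω = ⋃ i, P.coarse i
  loc_resolved : ∀ j, Resolved P.K (P.loc j)
  loc_cover : P.Ω = ⋃ j, P.loc j
  -- the eigenproblems on the coarse-space subdomains
  eigensystem : ∀ i, IsEigensystem (restrictedSpace P.K P.Ω P.r (P.coarse i))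
    (bForm P.A P.n P.k (P.coarse i)) (P.cForm i) (P.lam i) (P.p i)
  one_le_m : ∀ i, 1 ≤ (P.m i : ℕ)
  lam_pos : ∀ i, 0 < P.lam i (P.m i)

/-- `H_ℓ`: the maximal diameter of the local subdomains. -/
noncomputable def Hloc : ℝ := ⨆ j, Metric.diam (P.loc j)

/-- `Λ_ℓ` -/
noncomputable def Λloc : ℕ := overlapNumber P.K P.loc

/-- `Λ_c` -/
noncomputable def Λcoarse : ℕ := overlapNumber P.K P.coarse

/-- The eigenvalue tolerance `τ`: the minimum over the coarse-space subdomains of the first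
eigenvalue that is not selected. -/
noncomputable def τ : ℝ := ⨅ i, P.lam i (P.m i)

/-- `Θ = 1 / τ` -/
noncomputable def Θ : ℝ := 1 / P.τ

end Config

/-- `C_* = C_eig C_inv²` with `C_eig = Λ_c² n_min⁻¹ (a_max C_inv² + 2)²`. -/
noncomputable def Cstar (Λc : ℕ) (amax nmin Cinv : ℝ) : ℝ :=
  ((Λc : ℝ) ^ 2 * nmin⁻¹ * (amax * Cinv ^ 2 + 2) ^ 2) * Cinv ^ 2

namespace Config

variable {d : ℕ} (P : Config d)

/-- The constant `C_*` of the configuration. -/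
noncomputable def Cst : ℝ := Cstar P.Λcoarse P.amax P.nmin P.Cinv

/-- The quantity `s` of the convergence theorem; its condition is `s < 1`. -/
noncomputable def s (C₂ C₃ : ℝ) : ℝ :=
  2 * C₃ * (1 + P.Λloc * (P.Λcoarse : ℝ) ^ 2 * P.amax * P.nmin⁻¹ * P.Cst * P.Θ) *
    (2 * C₂ * P.Λcoarse * √(P.amax * P.nmin⁻¹ * P.Cst) * P.k * √P.Θ * (1 + P.Cstab)
      + 3 * P.k * P.Λloc * P.Hloc)

/-- The rate `γ` of the convergence theorem. -/
noncomputable def γ (C₂ C₃ : ℝ) : ℝ :=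
  (1 - P.s C₂ C₃) /
    (C₃ * (1 + P.Λloc * (P.Λcoarse : ℝ) ^ 2 * P.amax * P.nmin⁻¹ * P.Cst * P.Θ) *
      (18 + 8 * (P.Λloc : ℝ) ^ 2))

end Config

end HkGenEO

namespace HkGenEO

/-! ### Overlap numbers of families of subdomains -/

section Mesh

variable {d : ℕ} {K : Geometry.SimplicialComplex ℝ (E d)}

/-! Write `s = 2 C₃ F (X + Y)` with `F = 1 + (…) Θ`, where `X` is proportional to `Z = (1 + Cstab) k
√Θ` and `Y` to `k H_ℓ`. All other factors are constants at least `1`, apart from `C₂` and numbers.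
For (a), replacing these constants by `1` gives `s ≥ 4 C₂ Z + 6 k H_ℓ`, so `s < 1` bounds both terms
(`bounds_of_s_lt_one`). The only constants not at least `1` by assumption or elementary algebra are
the overlap numbers; `one_le_overlapNumber` handles them by finding an element inside some
subdomain. For (b), `k ≥ k₀` and `1 + Cstab ≥ 1` turn the bound on `Z²` into `Θ ≤ C / k₀²` (`Θ_le`).
By monotonicity `s` is then at most the quantity assumed to be below `1` (`s_le`), and the same
bound on `F` keeps `γ` away from zero (`le_γ`). No PDE or spectral theory enters. -/

lemma interior_convexHull_nonempty {T : Finset (E d)} (hT : T ∈ elements K) :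
    (interior (convexHull ℝ (T : Set (E d)))).Nonempty := by
  rw [interior_convexHull_nonempty_iff_affineSpan_eq_top]
  have hind := K.indep hT.1
  have h := hind.affineSpan_eq_top_iff_card_eq_finrank_add_one.2 (by simp [hT.2])
  simpa using h

/-- A resolved subdomain is only the interior of a union of elements, so an element is recovered
from it only after taking the closure. This works because a convex set with nonempty interior has
the same closure as its interior. -/
lemma convexHull_subset_closure_interior {T : Finset (E d)} (hT : T ∈ elements K) :
    convexHull ℝ (T : Set (E d)) ⊆ closure (interior (convexHull ℝ (T : Set (E d)))) := by
  rw [(convex_convexHull ℝ _).closure_interior_eq_closure_of_nonempty_interior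
    (interior_convexHull_nonempty hT)]
  exact subset_closure

lemma Resolved.exists_element {U : Set (E d)} (hU : Resolved K U) (hne : U.Nonempty) :
    ∃ T ∈ elements K, convexHull ℝ (T : Set (E d)) ⊆ closure U := by
  obtain ⟨S, hS, rfl⟩ := hU
  obtain ⟨x, hx⟩ := hne
  obtain ⟨T, hT, -⟩ := mem_iUnion₂.1 (interior_subset hx)
  exact ⟨T, hS hT, (convexHull_subset_closure_interior (hS hT)).trans
    (closure_mono (interior_mono (subset_biUnion_of_mem (u := fun T : Finset (E d) =>
      convexHull ℝ (T : Set (E d))) hT)))⟩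

/-- Needed because `sSup` of an unbounded set of naturals is `0`, which would defeat the lower bound
below. -/
lemma bddAbove_overlap (K : Geometry.SimplicialComplex ℝ (E d)) {N : ℕ}
    (U : Fin N → Set (E d)) :
    BddAbove {c | ∃ T ∈ elements K,
      c = {i | convexHull ℝ (T : Set (E d)) ⊆ closure (U i)}.ncard} := by
  refine ⟨N, ?_⟩
  rintro c ⟨T, -, rfl⟩
  simpa using Set.ncard_le_card {i | convexHull ℝ (T : Set (E d)) ⊆ closure (U i)}

/-- A family of resolved sets with nonempty union covers some element. -/
lemma one_le_overlapNumber {N : ℕ} {U : Fin N → Set (E d)} (hU : ∀ i, Resolved K (U i))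
    (hne : (⋃ i, U i).Nonempty) : 1 ≤ overlapNumber K U := by
  obtain ⟨x, hx⟩ := hne
  obtain ⟨i, hi⟩ := mem_iUnion.1 hx
  obtain ⟨T, hT, hTU⟩ := (hU i).exists_element ⟨x, hi⟩
  refine le_trans ?_ (le_csSup (bddAbove_overlap K U) ⟨T, hT, rfl⟩)
  exact (Set.ncard_pos (Set.toFinite _)).2 ⟨i, hTU⟩

end Mesh

/-! ### Signs and lower bounds of the constants -/

lemma Cstar_nonneg (Λc : ℕ) (amax Cinv : ℝ) {nmin : ℝ} (hn : 0 ≤ nmin) :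
    0 ≤ Cstar Λc amax nmin Cinv := by
  unfold Cstar
  positivity

lemma one_le_Cstar {Λc : ℕ} {amax nmin Cinv : ℝ} (hΛ : 1 ≤ Λc) (ha : 1 ≤ amax) (hn : 0 < nmin)
    (hn1 : nmin ≤ 1) (hC : 1 ≤ Cinv) : 1 ≤ Cstar Λc amax nmin Cinv := by
  have hΛ' : (1 : ℝ) ≤ Λc := by exact_mod_cast hΛ
  have h1 : 1 ≤ (Λc : ℝ) ^ 2 := one_le_pow₀ hΛ'
  have h2 : 1 ≤ nmin⁻¹ := (one_le_inv₀ hn).2 hn1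
  have h3 : 1 ≤ Cinv ^ 2 := one_le_pow₀ hC
  have h4 : 1 ≤ (amax * Cinv ^ 2 + 2) ^ 2 := one_le_pow₀ (by nlinarith)
  exact one_le_mul_of_one_le_of_one_le
    (one_le_mul_of_one_le_of_one_le (one_le_mul_of_one_le_of_one_le h1 h2) h4) h3

namespace Config

variable {d : ℕ} {P : Config d}

lemma Hloc_nonneg : 0 ≤ P.Hloc := Real.iSup_nonneg fun _ => Metric.diam_nonneg

namespace Valid

lemma one_le_Λloc (hP : P.Valid) : 1 ≤ P.Λloc :=
  one_le_overlapNumber hP.loc_resolved (hP.loc_cover ▸ hP.isConnected.nonempty)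

lemma one_le_Λcoarse (hP : P.Valid) : 1 ≤ P.Λcoarse :=
  one_le_overlapNumber hP.coarse_resolved (hP.coarse_cover ▸ hP.isConnected.nonempty)

/-- Only the sign of `Θ` is ever used, so positivity of the infimum is not needed: `1 / 0 = 0` is
harmless. -/
lemma Θ_nonneg (hP : P.Valid) : 0 ≤ P.Θ :=
  one_div_nonneg.2 (Real.iInf_nonneg fun i => (hP.lam_pos i).le)

lemma k_pos (hP : P.Valid) : 0 < P.k := hP.k₀_pos.trans_le hP.k₀_le

lemma one_le_inv_nmin (hP : P.Valid) : 1 ≤ P.nmin⁻¹ :=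
  (one_le_inv₀ hP.nmin_pos).2 hP.nmin_le_one

lemma one_le_Cst (hP : P.Valid) : 1 ≤ P.Cst :=
  one_le_Cstar hP.one_le_Λcoarse hP.one_le_amax hP.nmin_pos hP.nmin_le_one hP.one_le_Cinv

lemma one_le_contrast (hP : P.Valid) : 1 ≤ P.amax * P.nmin⁻¹ * P.Cst :=
  one_le_mul_of_one_le_of_one_le
    (one_le_mul_of_one_le_of_one_le hP.one_le_amax hP.one_le_inv_nmin) hP.one_le_Cst

lemma Θ_le (hP : P.Valid) {C : ℝ} (h : (1 + P.Cstab) ^ 2 * P.k ^ 2 * P.Θ ≤ C) :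
    P.Θ ≤ C * (P.k₀ ^ 2)⁻¹ := by
  have hk₀ : 0 < P.k₀ ^ 2 := pow_pos hP.k₀_pos 2
  rw [← div_eq_mul_inv, le_div_iff₀ hk₀]
  have hk : P.k₀ ^ 2 ≤ P.k ^ 2 := pow_le_pow_left₀ hP.k₀_pos.le hP.k₀_le 2
  have hs : 1 ≤ (1 + P.Cstab) ^ 2 := one_le_pow₀ (by linarith [hP.Cstab_pos])
  calc P.Θ * P.k₀ ^ 2 = 1 * P.k₀ ^ 2 * P.Θ := by ring
    _ ≤ (1 + P.Cstab) ^ 2 * P.k ^ 2 * P.Θ := by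
      have := hP.Θ_nonneg
      gcongr
    _ ≤ C := h

/-! ### Two-sided control of `s`, and the rate `γ` -/

lemma sq_stab_term (hP : P.Valid) :
    (P.k * √P.Θ * (1 + P.Cstab)) ^ 2 = (1 + P.Cstab) ^ 2 * P.k ^ 2 * P.Θ := by
  rw [mul_pow, mul_pow, Real.sq_sqrt hP.Θ_nonneg]
  ring

/-- Smallness of `s` bounds `k H_ℓ` and `(1 + C_stab) k Θ^{1/2}`. -/
lemma bounds_of_s_lt_one (hP : P.Valid) {C₂ C₃ : ℝ} (hC₂ : 0 < C₂) (hC₃ : 1 ≤ C₃)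
    (hs : P.s C₂ C₃ < 1) :
    P.k * P.Hloc ≤ 1 / 6 ∧ (1 + P.Cstab) ^ 2 * P.k ^ 2 * P.Θ ≤ (1 / (4 * C₂)) ^ 2 := by
  have hΘ := hP.Θ_nonneg
  have hk := hP.k_pos
  have hCs := hP.Cstab_pos
  have hH := P.Hloc_nonneg
  have ha := hP.one_le_amax
  have hn := hP.nmin_pos
  have hCst := hP.one_le_Cst
  have hΛl : (1 : ℝ) ≤ P.Λloc := by exact_mod_cast hP.one_le_Λloc
  have hΛc : (1 : ℝ) ≤ P.Λcoarse := by exact_mod_cast hP.one_le_Λcoarse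
  have hR : 1 ≤ √(P.amax * P.nmin⁻¹ * P.Cst) := Real.one_le_sqrt.2 hP.one_le_contrast
  have hZ : 0 ≤ P.k * √P.Θ * (1 + P.Cstab) := by positivity
  have hkH : 0 ≤ P.k * P.Hloc := by positivity
  have hF : 1 ≤ 1 + P.Λloc * (P.Λcoarse : ℝ) ^ 2 * P.amax * P.nmin⁻¹ * P.Cst * P.Θ := by
    have : 0 ≤ P.Λloc * (P.Λcoarse : ℝ) ^ 2 * P.amax * P.nmin⁻¹ * P.Cst * P.Θ := by positivity
    linarith
  have hG := one_le_mul_of_one_le_of_one_le hC₃ hF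
  have hX : 2 * C₂ * (P.k * √P.Θ * (1 + P.Cstab)) ≤
      2 * C₂ * P.Λcoarse * √(P.amax * P.nmin⁻¹ * P.Cst) * P.k * √P.Θ * (1 + P.Cstab) := by
    calc 2 * C₂ * (P.k * √P.Θ * (1 + P.Cstab))
        ≤ 2 * C₂ * (P.k * √P.Θ * (1 + P.Cstab)) *
            (P.Λcoarse * √(P.amax * P.nmin⁻¹ * P.Cst)) :=
          le_mul_of_one_le_right (by positivity) (one_le_mul_of_one_le_of_one_le hΛc hR)
      _ = _ := by ring
  have hY : 3 * (P.k * P.Hloc) ≤ 3 * P.k * P.Λloc * P.Hloc := by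
    nlinarith [mul_le_mul_of_nonneg_left hΛl hkH]
  have hsum : 0 ≤ 2 * C₂ * P.Λcoarse * √(P.amax * P.nmin⁻¹ * P.Cst) * P.k * √P.Θ * (1 + P.Cstab)
      + 3 * P.k * P.Λloc * P.Hloc := by positivity
  have key := mul_le_mul_of_nonneg_right hG hsum
  have hZ2 : 0 ≤ 2 * C₂ * (P.k * √P.Θ * (1 + P.Cstab)) := by positivity
  -- By `key`, `hX` and `hY`, the hypothesis yields `4 C₂ Z + 6 k H_ℓ < 1`; dropping one nonnegative
  -- term at a time gives `1 / 6` and `1 / (4 C₂)`.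
  unfold s at hs
  refine ⟨by linarith, ?_⟩
  rw [← hP.sq_stab_term]
  refine pow_le_pow_left₀ hZ ?_ 2
  rw [le_div_iff₀ (by positivity)]
  linarith

/-- The quantity `s` is controlled by bounds on `k H_ℓ` and `(1 + C_stab)² k² Θ`. -/
lemma s_le (hP : P.Valid) {C₂ C₃ C : ℝ} (hC₂ : 0 < C₂) (hC₃ : 1 ≤ C₃)
    (hH : P.k * P.Hloc ≤ C) (hΘC : (1 + P.Cstab) ^ 2 * P.k ^ 2 * P.Θ ≤ C) :
    P.s C₂ C₃ ≤
      2 * C₃ * (1 + P.Λloc * (P.Λcoarse : ℝ) ^ 2 * P.amax * P.nmin⁻¹ * P.Cst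
          * C * (P.k₀ ^ 2)⁻¹) *
        (2 * C₂ * P.Λcoarse * √(P.amax * P.nmin⁻¹ * P.Cst * C) + 3 * P.Λloc * C) := by
  have hΘ := hP.Θ_nonneg
  have hk := hP.k_pos
  have hCs := hP.Cstab_pos
  have hH0 := P.Hloc_nonneg
  have ha := hP.one_le_amax
  have hn := hP.nmin_pos
  have hCst := hP.one_le_Cst
  have hZ : P.k * √P.Θ * (1 + P.Cstab) ≤ √C :=
    Real.le_sqrt_of_sq_le (hP.sq_stab_term ▸ hΘC)
  have hF : P.Λloc * (P.Λcoarse : ℝ) ^ 2 * P.amax * P.nmin⁻¹ * P.Cst * P.Θ ≤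
      P.Λloc * (P.Λcoarse : ℝ) ^ 2 * P.amax * P.nmin⁻¹ * P.Cst * C * (P.k₀ ^ 2)⁻¹ := by
    rw [mul_assoc _ C]
    exact mul_le_mul_of_nonneg_left (hP.Θ_le hΘC) (by positivity)
  have hX : 2 * C₂ * P.Λcoarse * √(P.amax * P.nmin⁻¹ * P.Cst) * P.k * √P.Θ * (1 + P.Cstab) ≤
      2 * C₂ * P.Λcoarse * √(P.amax * P.nmin⁻¹ * P.Cst * C) := by
    rw [Real.sqrt_mul (zero_le_one.trans hP.one_le_contrast)]
    calc _ = 2 * C₂ * P.Λcoarse * √(P.amax * P.nmin⁻¹ * P.Cst) *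
            (P.k * √P.Θ * (1 + P.Cstab)) := by ring
      _ ≤ 2 * C₂ * P.Λcoarse * √(P.amax * P.nmin⁻¹ * P.Cst) * √C := by gcongr
      _ = _ := by ring
  have hY : 3 * P.k * P.Λloc * P.Hloc ≤ 3 * P.Λloc * C := by
    calc _ = 3 * P.Λloc * (P.k * P.Hloc) := by ring
      _ ≤ _ := by gcongr
  unfold s
  refine mul_le_mul (mul_le_mul_of_nonneg_left (by linarith) (by linarith)) (add_le_add hX hY)
    (by positivity) (mul_nonneg (by linarith) ?_)
  -- No sign of `C` is assumed: the bounding factor is nonnegative because, by `hF`, it dominates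
  -- the one with `Θ`.
  have : 0 ≤ P.Λloc * (P.Λcoarse : ℝ) ^ 2 * P.amax * P.nmin⁻¹ * P.Cst * P.Θ := by positivity
  linarith

/-- An upper bound for `s` and the bound on `Θ` give a lower bound for `γ`. -/
lemma le_γ (hP : P.Valid) {C₂ C₃ C S : ℝ} (hC₃ : 1 ≤ C₃) (hS : S < 1) (hsS : P.s C₂ C₃ ≤ S)
    (hΘC : (1 + P.Cstab) ^ 2 * P.k ^ 2 * P.Θ ≤ C) :
    (1 - S) / (C₃ * (1 + P.Λloc * (P.Λcoarse : ℝ) ^ 2 * P.amax * P.nmin⁻¹ * P.Cst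
        * C * (P.k₀ ^ 2)⁻¹) * (18 + 8 * (P.Λloc : ℝ) ^ 2)) ≤ P.γ C₂ C₃ := by
  have hΘ := hP.Θ_nonneg
  have ha := hP.one_le_amax
  have hn := hP.nmin_pos
  have hCst := hP.one_le_Cst
  have h : P.Λloc * (P.Λcoarse : ℝ) ^ 2 * P.amax * P.nmin⁻¹ * P.Cst * P.Θ ≤
      P.Λloc * (P.Λcoarse : ℝ) ^ 2 * P.amax * P.nmin⁻¹ * P.Cst * C * (P.k₀ ^ 2)⁻¹ := by
    rw [mul_assoc _ C]
    exact mul_le_mul_of_nonneg_left (hP.Θ_le hΘC) (by positivity)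
  unfold γ
  refine div_le_div₀ (by linarith) (by linarith) (by positivity) ?_
  gcongr

end Valid

end Config

end HkGenEO

theorem corollary3p2 (C₂ C₃ : ℝ) (hC₂ : 0 < C₂) (hC₃ : 1 ≤ C₃) :
    (∃ C : ℝ, 0 < C ∧ ∀ (d : ℕ) (P : HkGenEO.Config d), P.Valid → P.s C₂ C₃ < 1 →
      P.k * P.Hloc ≤ C ∧ (1 + P.Cstab) ^ 2 * P.k ^ 2 * P.Θ ≤ C) ∧
    (∀ (Λl Λc : ℕ) (amax nmin Cinv k₀ C : ℝ), 0 < C →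
      2 * C₃ * (1 + Λl * (Λc : ℝ) ^ 2 * amax * nmin⁻¹ * HkGenEO.Cstar Λc amax nmin Cinv
          * C * (k₀ ^ 2)⁻¹) *
        (2 * C₂ * Λc * √(amax * nmin⁻¹ * HkGenEO.Cstar Λc amax nmin Cinv * C)
          + 3 * Λl * C) < 1 →
      ∃ γ₀ : ℝ, 0 < γ₀ ∧ ∀ (d : ℕ) (P : HkGenEO.Config d), P.Valid →
        P.Λloc = Λl → P.Λcoarse = Λc → P.amax = amax → P.nmin = nmin → P.Cinv = Cinv →
        P.k₀ = k₀ →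
        P.k * P.Hloc ≤ C → (1 + P.Cstab) ^ 2 * P.k ^ 2 * P.Θ ≤ C →
        P.s C₂ C₃ < 1 ∧ γ₀ ≤ P.γ C₂ C₃) := by
  refine ⟨⟨max (1 / 6) ((1 / (4 * C₂)) ^ 2), by positivity, fun d P hP hs => ?_⟩, ?_⟩
  · obtain ⟨h₁, h₂⟩ := hP.bounds_of_s_lt_one hC₂ hC₃ hs
    exact ⟨le_max_of_le_left h₁, le_max_of_le_right h₂⟩
  · intro Λl Λc amax nmin Cinv k₀ C hC hS
    -- The prescribed constants are arbitrary reals. If one of these two is negative, no valid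
    -- configuration attains them and any `γ₀` serves.
    by_cases hpos : 0 ≤ amax ∧ 0 ≤ nmin
    · obtain ⟨ha, hn⟩ := hpos
      have hCst := HkGenEO.Cstar_nonneg Λc amax Cinv hn
      refine ⟨_, div_pos (sub_pos.2 hS) (?_ : 0 < C₃ * (1 + Λl * (Λc : ℝ) ^ 2 * amax * nmin⁻¹
        * HkGenEO.Cstar Λc amax nmin Cinv * C * (k₀ ^ 2)⁻¹) * (18 + 8 * (Λl : ℝ) ^ 2)), ?_⟩
      · positivity
      · rintro d P hP rfl rfl rfl rfl rfl rfl hH hΘ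
        have hs := hP.s_le hC₂ hC₃ hH hΘ
        exact ⟨hs.trans_lt hS, hP.le_γ hC₃ hS hs hΘ⟩
    · refine ⟨1, one_pos, ?_⟩
      rintro d P hP - - rfl rfl
      exact absurd ⟨zero_le_one.trans hP.one_le_amax, hP.nmin_pos.le⟩ hpos
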